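/- All graphs are undirected, simple, connected and nonempty, and are regarded as metric spaces through the path distance $d$ on their vertex set; $B_r(x)=\{y: d(x,y)\le r\}$ denotes the ball of radius $r$ around the vertex $x$. An action of a group $\Gamma$ on a graph $G$, that is, a homomorphism $\Gamma\to\mathrm{Aut}(G)$, is *geometric* if all vertex stabilizers are finite and there are only finitely many orbits of vertices and of edges (this forces $G$ to be locally finite). A graph is *Helly* if every family, finite or infinite, of pairwise intersecting balls has a common vertex, and a group is *Helly* if it acts geometrically on a Helly graph. A graph $G$ is *coarse Helly* if there is $\delta\ge 0$ such that $\bigcap_{i\in I}B_{r_i+\delta}(x_i)\neq\emptyset$ for every family $(B_{r_i}(x_i))_{i\in I}$ of pairwise intersecting balls of $G$. For $\beta\ge 1$, the graph $G$ has *$\beta$-stable intervals* if for all vertices $w,v,v'$ with $v$ adjacent to $v'$ the intervals $I(w,v)$ and $I(w,v')$ are at Hausdorff distance at most $\beta$, where $I(a,b)=\{x: d(a,x)+d(x,b)=d(a,b)\}$. The *discrete injective hull* (Hellyfication) $E^0(G)$ is the graph whose vertices are the pointwise minimal functions among all $f\colon V(G)\to\mathbb Z$ with $f(x)+f(y)\ge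 d(x,y)$ for all $x,y\in V(G)$, two such functions being adjacent when their sup-distance is $1$; the group $\mathrm{Aut}(G)$ acts on it by $(\varphi f)(x)=f(\varphi^{-1}x)$. **Theorem.** Let $\beta\ge 1$ and let $\Gamma$ be a group acting geometrically on a coarse Helly graph $G$ with $\beta$-stable intervals. Then $\Gamma$ is a Helly group. More precisely, $E^0(G)$ is a Helly graph and the induced action of $\Gamma$ on $E^0(G)$ is geometric. -/

import Mathlib

universe u v

namespace HellyGroups

section Graphs

variable {V : Type v}

/-- The closed ball of radius `r` around the vertex `x`, for the path metric of `G`. -/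
def ball (G : SimpleGraph V) (x : V) (r : ℕ) : Set V :=
  {y | G.dist x y ≤ r}

/-- A set `S` of pairs (centre, radius), seen as a family of balls, is pairwise intersecting. -/
def PairwiseIntersecting (G : SimpleGraph V) (S : Set (V × ℕ)) : Prop :=
  ∀ p ∈ S, ∀ q ∈ S, (ball G p.1 p.2 ∩ ball G q.1 q.2).Nonempty

/-- A Helly graph: a connected graph in which every family (finite or infinite) of pairwise
intersecting balls has a common vertex. -/
structure IsHellyGraph (G : SimpleGraph V) : Prop where
  connected : G.Connected
  helly : ∀ S : Set (V × ℕ), PairwiseIntersecting G S → ∃ z : V, ∀ p ∈ S, z ∈ ball G p.1 p.2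

/-- The coarse Helly property of the vertex set with the path metric: there is `δ ≥ 0` such that for
every family `B(x_i, r_i)` of pairwise intersecting balls, the balls `B(x_i, r_i + δ)` have a common
vertex. (Path distances are integers, so balls of integer radius are all the balls.) -/
def IsCoarseHelly (G : SimpleGraph V) : Prop :=
  ∃ δ : ℝ, 0 ≤ δ ∧ ∀ S : Set (V × ℕ), PairwiseIntersecting G S →
    ∃ z : V, ∀ p ∈ S, (G.dist p.1 z : ℝ) ≤ (p.2 : ℝ) + δ

/-- The interval `I(a, b)`: all vertices on shortest paths from `a` to `b`. -/
def interval (G : SimpleGraph V) (a b : V) : Set V :=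
  {x | G.dist a x + G.dist x b = G.dist a b}

/-- The Hausdorff distance of the vertex sets `A` and `B` is at most `β`. (Path distances are
integers, so the distance from a vertex to a nonempty set is attained.) -/
def HausdorffDistLE (G : SimpleGraph V) (A B : Set V) (β : ℝ) : Prop :=
  (∀ x ∈ A, ∃ y ∈ B, (G.dist x y : ℝ) ≤ β) ∧ (∀ y ∈ B, ∃ x ∈ A, (G.dist x y : ℝ) ≤ β)

/-- `G` has `β`-stable intervals. -/
def HasStableIntervals (G : SimpleGraph V) (β : ℝ) : Prop :=
  ∀ w a b : V, G.Adj a b → HausdorffDistLE G (interval G w a) (interval G w b) β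

/-- An action of `Γ` on a graph `G` by automorphisms is geometric: it is properly discontinuous
(stabilizers of vertices, hence also of edges, are finite) and cocompact (`G` is covered by the
translates of a finite subgraph, i.e. there are finitely many orbits of vertices and of edges).
These two conditions force `G` to be locally finite. -/
structure IsGeometricAction {Γ : Type u} [Group Γ] {G : SimpleGraph V} (ρ : Γ →* (G ≃g G)) :
    Prop where
  finite_stabilizer : ∀ x : V, {g : Γ | ρ g x = x}.Finite
  cocompact : ∃ K : Set V, K.Finite ∧ (∀ x : V, ∃ g : Γ, ρ g x ∈ K) ∧
    ∀ x y : V, G.Adj x y → ∃ g : Γ, ρ g x ∈ K ∧ ρ g y ∈ K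

end Graphs

/-- A Helly group: a group acting geometrically on a Helly graph. (Such a graph is connected and
locally finite, hence countable, so graphs on vertex sets in `Type` are all that is needed.) -/
def IsHellyGroup (Γ : Type u) [Group Γ] : Prop :=
  ∃ (W : Type) (H : SimpleGraph W) (ρ : Γ →* (H ≃g H)), IsHellyGraph H ∧ IsGeometricAction ρ

section Hull

variable {V : Type v}

/-- Integer metric forms on the vertex set with the path metric. -/
def IsIntegerMetricForm (G : SimpleGraph V) (f : V → ℤ) : Prop :=
  ∀ x y : V, (G.dist x y : ℤ) ≤ f x + f y

/-- The points of the discrete injective hull `E⁰(G)`: the extremal (pointwise minimal) integer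
metric forms. -/
def Hull (G : SimpleGraph V) : Type v :=
  {f : V → ℤ // Minimal (IsIntegerMetricForm G) f}

/-- The graph structure on the discrete injective hull: `f` and `g` are adjacent when their
sup-distance is `1`. -/
def hullGraph (G : SimpleGraph V) : SimpleGraph (Hull G) where
  Adj f g := f ≠ g ∧ ∀ x : V, |f.1 x - g.1 x| ≤ 1
  symm := ⟨fun f g h => ⟨h.1.symm, fun x => by rw [abs_sub_comm]; exact h.2 x⟩⟩
  loopless := ⟨fun _ h => h.1 rfl⟩

theorem dist_iso_le {G : SimpleGraph V} (φ : G ≃g G) (x y : V) :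
    G.dist (φ x) (φ y) ≤ G.dist x y := by
  by_cases h : G.Reachable x y
  · obtain ⟨p, hp⟩ := h.exists_walk_length_eq_dist
    rw [← hp, ← SimpleGraph.Walk.length_map φ.toHom p]
    exact SimpleGraph.dist_le (p.map φ.toHom)
  · rw [SimpleGraph.dist_eq_zero_of_not_reachable (fun h' => h (φ.reachable_iff.1 h'))]
    exact Nat.zero_le _

theorem dist_iso {G : SimpleGraph V} (φ : G ≃g G) (x y : V) :
    G.dist (φ x) (φ y) = G.dist x y := by
  refine le_antisymm (dist_iso_le φ x y) ?_
  simpa using dist_iso_le φ.symm (φ x) (φ y)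

theorem IsIntegerMetricForm.comp {G : SimpleGraph V} {f : V → ℤ} (hf : IsIntegerMetricForm G f)
    (φ : G ≃g G) : IsIntegerMetricForm G (fun x => f (φ x)) := fun x y => by
  rw [← dist_iso φ x y]
  exact hf _ _

/-- An automorphism `φ` of `G` maps the form `f` to the form `x ↦ f (φ⁻¹ x)`. -/
def hullMap {G : SimpleGraph V} (φ : G ≃g G) (f : Hull G) : Hull G :=
  ⟨fun x => f.1 (φ.symm x), f.2.1.comp φ.symm, fun g hg hle x => by
    have h := f.2.2 (hg.comp φ) (fun y => by simpa using hle (φ y)) (φ.symm x)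
    simpa using h⟩

/-- The action of `Aut(G)` on the discrete injective hull, by graph automorphisms. It extends the
action on `G` along the embedding `x ↦ d(x, ·)`. -/
def hullAut (G : SimpleGraph V) : (G ≃g G) →* (hullGraph G ≃g hullGraph G) where
  toFun φ :=
    { toFun := hullMap φ
      invFun := hullMap φ.symm
      left_inv := fun f => Subtype.ext (funext fun x => by simp [hullMap])
      right_inv := fun f => Subtype.ext (funext fun x => by simp [hullMap])
      map_rel_iff' := by
        intro f g
        have hinj : Function.Injective (hullMap φ) := fun f g h => by
          refine Subtype.ext (funext fun x => ?_)
          simpa [hullMap] using congrFun (congrArg Subtype.val h) (φ x)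
        refine and_congr hinj.ne_iff ⟨fun h x => ?_, fun h x => h _⟩
        have h' : |f.1 (φ.symm (φ x)) - g.1 (φ.symm (φ x))| ≤ 1 := h (φ x)
        simpa using h' }
  map_one' := rfl
  map_mul' _ _ := rfl

end Hull

end HellyGroups

namespace HellyGroups

/-! ### Extremal forms: tightness, hyperconvexity, and the effect of the coarse Helly property. -/

section Hull

variable {V : Type v} {G : SimpleGraph V}

/-! An extremal form `f` is tight: every `x` has a `y` with `f x + f y = d(x, y)`. Tightness makes
the hull hyperconvex for the sup-distance, which is also its path distance, so the hull is Helly for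
every connected `G` (`isHellyGraph_hullGraph`).

The other hypotheses serve the action. Coarse Helly gives each `f` a point `z` with `f z ≤ N`, `N`
uniform (`IsCoarseHelly.exists_hull_le`): every point of the hull lies near `G`. Stable intervals
make each set `{f | f z ≤ N}` finite (`HasStableIntervals.finite_hull`): the difference `f x - d(x,
z)` lies in `[-N, N]` and depends on `x` only through `d(x, ·) - d(x, z)` on a fixed ball around
`z`, which leaves finitely many possibilities. With these two facts, finiteness of stabilizers and
of orbits passes from `G` to the hull (`IsGeometricAction.hull`). -/

theorem IsIntegerMetricForm.nonneg {f : V → ℤ} (hf : IsIntegerMetricForm G f) (x : V) :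
    0 ≤ f x := by
  have := hf x x
  omega

/-- A nonempty chain of integer metric forms is bounded below by an integer metric form. -/
theorem IsIntegerMetricForm.exists_lower_bound {c : Set (V → ℤ)}
    (hc : ∀ f ∈ c, IsIntegerMetricForm G f) (hchain : ∀ f ∈ c, ∀ g ∈ c, f ≤ g ∨ g ≤ f)
    (hne : c.Nonempty) : ∃ h, IsIntegerMetricForm G h ∧ ∀ f ∈ c, h ≤ f := by
  have hbdd : ∀ x, BddBelow ((fun f : V → ℤ => f x) '' c) := fun x =>
    ⟨0, by rintro _ ⟨f, hf, rfl⟩; exact (hc f hf).nonneg x⟩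
  refine ⟨fun x => sInf ((fun f : V → ℤ => f x) '' c), fun x y => ?_, fun f hf x =>
    csInf_le (hbdd x) ⟨f, hf, rfl⟩⟩
  obtain ⟨f, hf, hfx⟩ := Int.csInf_mem (hne.image fun f : V → ℤ => f x) (hbdd x)
  obtain ⟨g, hg, hgy⟩ := Int.csInf_mem (hne.image fun f : V → ℤ => f y) (hbdd y)
  simp only at hfx hgy
  change (G.dist x y : ℤ) ≤ sInf _ + sInf _
  rw [← hfx, ← hgy]
  -- The smaller of `f` and `g` is at most both attained infima, so its own inequality suffices.
  rcases hchain f hf g hg with h | h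
  · have := hc f hf x y
    have : f y ≤ g y := h y
    omega
  · have := hc g hg x y
    have : g x ≤ f x := h x
    omega

/-- Every integer metric form dominates an extremal one. -/
theorem IsIntegerMetricForm.exists_hull_le {F : V → ℤ} (hF : IsIntegerMetricForm G F) :
    ∃ h : Hull G, ∀ x, h.1 x ≤ F x := by
  obtain ⟨m, hm, hmax⟩ := zorn_le_nonempty₀ (α := (V → ℤ)ᵒᵈ)
    {f | IsIntegerMetricForm G (OrderDual.ofDual f)}
    (fun c hc hchain y hy => by
      obtain ⟨h, hh, hle⟩ := IsIntegerMetricForm.exists_lower_bound (G := G)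
        (c := OrderDual.toDual ⁻¹' c) (fun f hf => hc hf)
        (fun f hf g hg => (hchain.total hf hg).symm) ⟨OrderDual.ofDual y, hy⟩
      exact ⟨OrderDual.toDual h, hh, fun z hz => hle (OrderDual.ofDual z) hz⟩)
    (OrderDual.toDual F) hF
  exact ⟨⟨OrderDual.ofDual m, hmax.1, fun g hg hle => hmax.2 (y := OrderDual.toDual g) hg hle⟩, hm⟩

theorem Hull.nonneg (f : Hull G) (x : V) : 0 ≤ f.1 x :=
  f.2.1.nonneg x

/-- Without such a `y`, lowering `f` by one at `x` would leave an integer metric form, against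
minimality. -/
theorem Hull.exists_add_eq_dist (f : Hull G) (x : V) :
    ∃ y, f.1 x + f.1 y = G.dist x y := by
  classical
  by_contra! h
  have hlt : ∀ y, (G.dist x y : ℤ) + 1 ≤ f.1 x + f.1 y := fun y =>
    Int.add_one_le_of_lt (lt_of_le_of_ne (f.2.1 x y) (h y).symm)
  have hform : IsIntegerMetricForm G (Function.update f.1 x (f.1 x - 1)) := by
    intro a b
    have hab := f.2.1 a b
    have ha := hlt a
    have hb := hlt b
    rw [SimpleGraph.dist_comm] at ha
    simp only [Function.update_apply]
    split_ifs with hax hbx hbx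
    -- On the diagonal, `2 f(x) ≥ 1` and integrality give `f(x) ≥ 1`.
    · subst hax hbx
      rw [SimpleGraph.dist_self] at *
      omega
    · subst hax
      omega
    · subst hbx
      omega
    · exact hab
  have hle : Function.update f.1 x (f.1 x - 1) ≤ f.1 := by
    rw [update_le_self_iff]
    exact sub_le_self _ zero_le_one
  have := f.2.2 hform hle x
  simp at this

theorem Hull.le_add_dist (hconn : G.Connected) (f : Hull G) (x y : V) :
    f.1 x ≤ f.1 y + G.dist x y := by
  obtain ⟨w, hw⟩ := f.exists_add_eq_dist x
  have h1 := hconn.dist_triangle (u := x) (v := y) (w := w)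
  have h2 := f.2.1 y w
  omega

/-- The discrete injective hull is hyperconvex for the sup-distance. -/
theorem Hull.exists_close {S : Set (Hull G × ℕ)} (hne : S.Nonempty)
    (hS : ∀ p ∈ S, ∀ q ∈ S, ∀ x, p.1.1 x ≤ q.1.1 x + p.2 + q.2) :
    ∃ h : Hull G, ∀ p ∈ S, ∀ x, |h.1 x - p.1.1 x| ≤ p.2 := by
  have hbdd : ∀ x, BddBelow ((fun p : Hull G × ℕ => p.1.1 x + p.2) '' S) := fun x =>
    ⟨0, by
      rintro _ ⟨p, hp, rfl⟩
      exact add_nonneg (p.1.nonneg x) (Int.natCast_nonneg _)⟩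
  have hF : IsIntegerMetricForm G
      fun x => sInf ((fun p : Hull G × ℕ => p.1.1 x + p.2) '' S) := by
    intro x y
    obtain ⟨p, hp, hpx⟩ := Int.csInf_mem (hne.image fun p : Hull G × ℕ => p.1.1 x + p.2) (hbdd x)
    obtain ⟨q, hq, hqy⟩ := Int.csInf_mem (hne.image fun p : Hull G × ℕ => p.1.1 y + p.2) (hbdd y)
    simp only at hpx hqy
    change (G.dist x y : ℤ) ≤ sInf _ + sInf _
    rw [← hpx, ← hqy]
    have := hS q hq p hp x
    have := q.1.2.1 x y
    omega
  obtain ⟨h, hh⟩ := hF.exists_hull_le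
  refine ⟨h, fun p hp x => ?_⟩
  have hle : ∀ x, h.1 x ≤ p.1.1 x + p.2 := fun x => (hh x).trans (csInf_le (hbdd x) ⟨p, hp, rfl⟩)
  -- A tight partner `y` of `x` turns the upper bound on `h y` into the lower bound on `h x`.
  obtain ⟨y, hy⟩ := p.1.exists_add_eq_dist x
  have h1 := h.2.1 x y
  have h2 := hle x
  have h3 := hle y
  rw [abs_le]
  constructor <;> omega

theorem hullGraph_abs_sub_le_length {f g : Hull G} (p : (hullGraph G).Walk f g) (x : V) :
    |f.1 x - g.1 x| ≤ p.length := by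
  induction p with
  | nil => simp
  | cons h p ih =>
    have h1 := h.2 x
    rw [SimpleGraph.Walk.length_cons]
    rw [abs_le] at *
    push_cast
    constructor <;> omega

/-- Hyperconvexity, applied to the balls of radius `1` around `f` and `k` around `g`, yields the
first step of the walk. -/
theorem hullGraph_exists_walk {k : ℕ} {f g : Hull G} (h : ∀ x, |f.1 x - g.1 x| ≤ k) :
    ∃ p : (hullGraph G).Walk f g, p.length ≤ k := by
  induction k generalizing f with
  | zero =>
    obtain rfl : f = g := Subtype.ext (funext fun x => by simpa [sub_eq_zero] using h x)
    exact ⟨.nil, le_rfl⟩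
  | succ k ih =>
    have hS : ∀ p ∈ ({(f, 1), (g, k)} : Set (Hull G × ℕ)), ∀ q ∈ ({(f, 1), (g, k)} : Set _),
        ∀ x, p.1.1 x ≤ q.1.1 x + p.2 + q.2 := by
      intro p hp q hq x
      have := abs_le.1 (h x)
      push_cast at this
      rcases hp with rfl | rfl <;> rcases hq with rfl | rfl <;> simp <;> omega
    obtain ⟨m, hm⟩ := Hull.exists_close (Set.insert_nonempty _ _) hS
    have hf := hm (f, 1) (by simp)
    have hg := hm (g, k) (by simp)
    obtain ⟨p, hp⟩ := ih hg
    by_cases hfm : f = m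
    · subst hfm
      exact ⟨p, hp.trans k.le_succ⟩
    · have hadj : (hullGraph G).Adj f m :=
        ⟨hfm, fun x => by rw [abs_sub_comm]; exact_mod_cast hf x⟩
      exact ⟨.cons hadj p, by simpa using hp⟩

theorem hullGraph_connected (hconn : G.Connected) : (hullGraph G).Connected := by
  obtain ⟨x₀⟩ := hconn.nonempty
  have hform : IsIntegerMetricForm G fun x => G.dist x x₀ := fun x y => by
    have := hconn.dist_triangle (u := x) (v := x₀) (w := y)
    rw [SimpleGraph.dist_comm (u := x₀)] at this
    change (G.dist x y : ℤ) ≤ G.dist x x₀ + G.dist y x₀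
    exact_mod_cast this
  obtain ⟨f₀, -⟩ := hform.exists_hull_le
  have : Nonempty (Hull G) := ⟨f₀⟩
  refine SimpleGraph.Connected.mk fun f g => ?_
  have hbound : ∀ x, |f.1 x - g.1 x| ≤ (f.1 x₀ + g.1 x₀).toNat := fun x => by
    rw [Int.toNat_of_nonneg (add_nonneg (f.nonneg _) (g.nonneg _))]
    have h1 := f.le_add_dist hconn x x₀
    have h2 := g.le_add_dist hconn x x₀
    have h3 := f.2.1 x x₀
    have h4 := g.2.1 x x₀
    rw [abs_le]
    constructor <;> omega
  obtain ⟨p, -⟩ := hullGraph_exists_walk hbound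
  exact p.reachable

theorem hullGraph_dist_le_iff (hconn : G.Connected) {f g : Hull G} {k : ℕ} :
    (hullGraph G).dist f g ≤ k ↔ ∀ x, |f.1 x - g.1 x| ≤ k := by
  constructor
  · intro h x
    obtain ⟨p, hp⟩ := (hullGraph_connected hconn).exists_walk_length_eq_dist f g
    exact (hullGraph_abs_sub_le_length p x).trans (by rw [hp]; exact_mod_cast h)
  · intro h
    obtain ⟨p, hp⟩ := hullGraph_exists_walk h
    exact (SimpleGraph.dist_le p).trans hp

/-- The discrete injective hull of a connected graph is a Helly graph. -/
theorem isHellyGraph_hullGraph (hconn : G.Connected) : IsHellyGraph (hullGraph G) := by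
  refine ⟨hullGraph_connected hconn, fun S hS => ?_⟩
  rcases S.eq_empty_or_nonempty with rfl | hne
  · obtain ⟨f⟩ := (hullGraph_connected hconn).nonempty
    exact ⟨f, by simp⟩
  obtain ⟨h, hh⟩ := Hull.exists_close hne fun p hp q hq x => by
    obtain ⟨m, hmp, hmq⟩ := hS p hp q hq
    have h1 := abs_le.1 ((hullGraph_dist_le_iff hconn).1 hmp x)
    have h2 := abs_le.1 ((hullGraph_dist_le_iff hconn).1 hmq x)
    omega
  refine ⟨h, fun p hp => (hullGraph_dist_le_iff hconn).2 fun x => ?_⟩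
  rw [abs_sub_comm]
  exact hh p hp x

/-- In a coarse Helly graph, every point of the discrete injective hull takes a uniformly bounded
value somewhere. -/
theorem IsCoarseHelly.exists_hull_le (hconn : G.Connected) (h : IsCoarseHelly G) :
    ∃ N : ℕ, ∀ f : Hull G, ∃ z, f.1 z ≤ N := by
  obtain ⟨δ, -, hδ⟩ := h
  refine ⟨⌈δ⌉₊, fun f => ?_⟩
  -- The balls of radius `f x` around `x` meet pairwise along geodesics, since `d(x, y) ≤ f x + f
  -- y`. If `f x` exceeds the length of the geodesic, `getVert` returns `y`, which still serves.
  obtain ⟨z, hz⟩ := hδ (Set.range fun x => (x, (f.1 x).toNat)) (by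
    rintro _ ⟨x, rfl⟩ _ ⟨y, rfl⟩
    have hx := Int.toNat_of_nonneg (f.nonneg x)
    have hy := Int.toNat_of_nonneg (f.nonneg y)
    have hxy := f.2.1 x y
    obtain ⟨p, hp⟩ := hconn.exists_walk_length_eq_dist x y
    refine ⟨p.getVert (f.1 x).toNat, ?_, ?_⟩
    · exact (SimpleGraph.dist_le (p.take _)).trans (by simp)
    · rw [ball, Set.mem_ofPred_eq, SimpleGraph.dist_comm]
      refine (SimpleGraph.dist_le (p.drop _)).trans ?_
      rw [SimpleGraph.Walk.drop_length]
      change p.length - _ ≤ (f.1 y).toNat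
      omega)
  -- For `y` tight with `z`, `f z = d(z, y) - f y ≤ ⌈δ⌉`.
  obtain ⟨y, hy⟩ := f.exists_add_eq_dist z
  refine ⟨z, ?_⟩
  have h1 := hz _ ⟨y, rfl⟩
  simp only at h1
  have h2 : G.dist y z ≤ (f.1 y).toNat + ⌈δ⌉₊ := by
    have := Nat.le_ceil δ
    exact_mod_cast h1.trans (add_le_add_right this _)
  have := Int.toNat_of_nonneg (f.nonneg y)
  rw [SimpleGraph.dist_comm] at hy
  omega

end Hull

/-! ### Stable intervals and finiteness of the sets `{f | f z ≤ N}`. -/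

section StableIntervals

variable {V : Type v} {G : SimpleGraph V}

theorem HasStableIntervals.exists_mem_interval {β : ℝ} (h : HasStableIntervals G β)
    {w a b x : V} (hab : G.Adj a b) (hx : x ∈ interval G w a) :
    ∃ y ∈ interval G w b, G.dist x y ≤ ⌊β⌋₊ := by
  obtain ⟨y, hy, hxy⟩ := (h w a b hab).1 x hx
  exact ⟨y, hy, Nat.le_floor hxy⟩

/-- If the walk `p` from `z` to `x` increases the distance to `y` up to an error `k`, then points of
`I(y, z)` are close to `I(y, x)`. -/
theorem HasStableIntervals.exists_near_interval {β : ℝ} (h : HasStableIntervals G β)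
    (hconn : G.Connected) (y : V) {z x : V} (p : G.Walk z x) {k : ℕ}
    (hk : p.length + G.dist y z ≤ G.dist y x + k) {a : V} (ha : a ∈ interval G y z) :
    ∃ v ∈ interval G y x, G.dist a v ≤ ⌊β⌋₊ * k := by
  induction p generalizing k a with
  | nil => exact ⟨a, ha, by simp⟩
  | @cons z z' x hadj p ih =>
    rw [SimpleGraph.Walk.length_cons] at hk
    have hzz' := SimpleGraph.dist_eq_one_iff_adj.2 hadj
    have h1 := hconn.dist_triangle (u := y) (v := z) (w := z')
    -- A step away from `y` gives `I(y, z) ⊆ I(y, z')`, so `a` stays. Any other step uses up at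
    -- least one unit of the error `k`, and stability moves `a` by at most `⌊β⌋`.
    by_cases hcase : G.dist y z + 1 ≤ G.dist y z'
    · refine ih (by omega) ?_
      have h2 := hconn.dist_triangle (u := a) (v := z) (w := z')
      have h3 := hconn.dist_triangle (u := y) (v := a) (w := z')
      simp only [interval, Set.mem_ofPred_eq] at ha ⊢
      omega
    · obtain ⟨a', ha', haa'⟩ := h.exists_mem_interval hadj ha
      have h2 := hconn.dist_triangle (u := y) (v := z') (w := x)
      have h3 := SimpleGraph.dist_le p
      obtain ⟨k, rfl⟩ : ∃ j, k = j + 1 := ⟨k - 1, by omega⟩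
      obtain ⟨v, hv, hav⟩ := ih (k := k) (by omega) ha'
      have h4 := hconn.dist_triangle (u := a) (v := a') (w := v)
      exact ⟨v, hv, by rw [mul_add, mul_one]; omega⟩

/-- Whether `v` lies on a shortest path from `x` to `y` can be tested with the distances from `x` to
the points of a small ball around `v`. -/
theorem HasStableIntervals.mem_interval {β : ℝ} (h : HasStableIntervals G β)
    (hconn : G.Connected) (x v y : V)
    (hv : ∀ u, G.dist v u ≤ ⌊β⌋₊ → G.dist x v + G.dist v y ≤ G.dist x u + G.dist u y) :
    v ∈ interval G x y := by
  obtain ⟨n, hn⟩ : ∃ n, G.dist y v = n := ⟨_, rfl⟩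
  induction n generalizing y with
  | zero =>
    obtain rfl := hconn.dist_eq_zero_iff.1 hn
    simp [interval]
  | succ n ih =>
    obtain ⟨p, hp⟩ := hconn.exists_walk_length_eq_dist y v
    cases p with
    | nil => simp at hn
    | @cons _ y' _ hadj p =>
      rw [SimpleGraph.Walk.length_cons] at hp
      have hyy' := SimpleGraph.dist_eq_one_iff_adj.2 hadj
      have h1 := SimpleGraph.dist_le p
      have h2 := hconn.dist_triangle (u := y) (v := y') (w := v)
      -- Moving from `y` to `y'` lowers `d(v, ·)` by exactly one and `d(u, ·)` by at most one, so
      -- the minimality of `v` persists.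
      have hmem := ih y' (fun u hu => by
        have h3 := hv u hu
        have h4 := hconn.dist_triangle (u := u) (v := y') (w := y)
        rw [SimpleGraph.dist_comm (u := y') (v := y)] at h4
        rw [SimpleGraph.dist_comm (u := v) (v := y)] at h3
        rw [SimpleGraph.dist_comm (u := v) (v := y')]
        omega) (by omega)
      -- Stability gives `u ∈ I(x, y)` within `⌊β⌋` of `v`; the hypothesis compares `v` with this
      -- `u`, whose distance sum is `d(x, y)`.
      obtain ⟨u, hu, hvu⟩ := h.exists_mem_interval hadj.symm hmem
      have h3 := hv u hvu
      have h4 := hconn.dist_triangle (u := x) (v := v) (w := y)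
      simp only [interval, Set.mem_ofPred_eq] at hu ⊢
      omega

/-- A point `f` of the hull with `f z ≤ N` satisfies `f x' - f x = d(x', z) - d(x, z)` as soon as
`d(x, ·)` and `d(x', ·)` differ by a constant on a large ball around `z`. -/
theorem HasStableIntervals.hull_sub_le {β : ℝ} (h : HasStableIntervals G β)
    (hconn : G.Connected) {z : V} {N : ℕ} {f : Hull G} (hf : f.1 z ≤ N) {x x' : V}
    (hxx' : ∀ v, G.dist z v ≤ ⌊β⌋₊ * (2 * N) + ⌊β⌋₊ →
      (G.dist x v : ℤ) - G.dist x z = G.dist x' v - G.dist x' z) :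
    f.1 x - G.dist x z ≤ f.1 x' - G.dist x' z := by
  obtain ⟨y, hy⟩ := f.exists_add_eq_dist x
  obtain ⟨p, hp⟩ := hconn.exists_walk_length_eq_dist z x
  have h1 := f.le_add_dist hconn x z
  have h2 := f.2.1 x z
  have h3 := f.2.1 y z
  -- The error `2 * N` arises from `d(x, z) + d(z, y) ≤ f x + f y + 2 f z = d(x, y) + 2 f z`. Thus
  -- `z` is close to some `v ∈ I(y, x)`.
  obtain ⟨v, hv, hzv⟩ := h.exists_near_interval hconn y p (k := 2 * N) (a := z) (by
    rw [hp, SimpleGraph.dist_comm (u := y) (v := x), SimpleGraph.dist_comm (u := z) (v := x)]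
    omega) (by simp [interval])
  -- Near `v` the sums `d(x, ·) + d(·, y)` and `d(x', ·) + d(·, y)` differ by a constant, so `v` is
  -- a local minimum for `x'` too. The extra `⌊β⌋` in the radius makes room for the test points `u`.
  have hmem : v ∈ interval G x' y := by
    refine h.mem_interval hconn x' v y fun u hu => ?_
    have h4 := hconn.dist_triangle (u := z) (v := v) (w := u)
    have h5 := hxx' v (by omega)
    have h6 := hxx' u (by omega)
    have h7 := hconn.dist_triangle (u := x) (v := u) (w := y)
    simp only [interval, Set.mem_ofPred_eq] at hv
    rw [SimpleGraph.dist_comm (u := y) (v := v), SimpleGraph.dist_comm (u := v) (v := x),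
      SimpleGraph.dist_comm (u := y) (v := x)] at hv
    omega
  have h4 := hxx' v (by omega)
  have h5 := f.2.1 x' y
  simp only [interval, Set.mem_ofPred_eq] at hv hmem
  rw [SimpleGraph.dist_comm (u := y) (v := v), SimpleGraph.dist_comm (u := v) (v := x),
    SimpleGraph.dist_comm (u := y) (v := x)] at hv
  omega

/-- By `hull_sub_le` in both directions, `f x - d(x, z)` depends only on the local distance profile
of `x` around `z`. There are finitely many profiles, each with finitely many admissible values. -/
theorem HasStableIntervals.finite_hull {β : ℝ} (h : HasStableIntervals G β)
    (hconn : G.Connected) (hfin : ∀ x r, (ball G x r).Finite) (z : V) (N : ℕ) :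
    {f : Hull G | f.1 z ≤ N}.Finite := by
  obtain ⟨R, hR⟩ : ∃ R, R = ⌊β⌋₊ * (2 * N) + ⌊β⌋₊ := ⟨_, rfl⟩
  have : Finite (ball G z R) := hfin z R
  let φ : V → ball G z R → ℤ := fun x v => (G.dist x v : ℤ) - G.dist x z
  have hφ : (Set.range φ).Finite := by
    refine (Set.Finite.pi' fun _ : ball G z R => Set.finite_Icc (-(R : ℤ)) R).subset ?_
    rintro _ ⟨x, rfl⟩ ⟨v, hv⟩
    have h1 := hconn.dist_triangle (u := x) (v := z) (w := v)
    have h2 := hconn.dist_triangle (u := x) (v := v) (w := z)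
    rw [SimpleGraph.dist_comm (u := v) (v := z)] at h2
    rw [ball, Set.mem_ofPred_eq] at hv
    simp only [φ, Set.mem_Icc]
    constructor <;> omega
  have : Finite (Set.range φ) := hφ
  choose rep hrep using fun q : Set.range φ => q.2
  -- `f` is encoded by its normalised values at one representative of each profile; the bound `[-N,
  -- N]` combines the Lipschitz property with `d(x, z) ≤ f x + f z`.
  refine Set.Finite.of_injOn (t := {g : Set.range φ → ℤ | ∀ q, g q ∈ Set.Icc (-(N : ℤ)) N})
    (f := fun f q => f.1 (rep q) - (G.dist (rep q) z : ℤ)) (fun f hf q => ?_) (fun f hf g hg hfg => ?_)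
    (Set.Finite.pi' fun _ => Set.finite_Icc _ _)
  · have h1 := f.le_add_dist hconn (rep q) z
    have h2 := f.2.1 (rep q) z
    rw [Set.mem_ofPred_eq] at hf
    change -(N : ℤ) ≤ f.1 (rep q) - G.dist (rep q) z ∧ f.1 (rep q) - G.dist (rep q) z ≤ N
    constructor <;> omega
  · refine Subtype.ext (funext fun x => ?_)
    have hx := hrep ⟨φ x, x, rfl⟩
    have hval := congrFun hfg ⟨φ x, x, rfl⟩
    simp only at hx hval
    have hloc : ∀ v, G.dist z v ≤ ⌊β⌋₊ * (2 * N) + ⌊β⌋₊ →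
        (G.dist (rep ⟨φ x, x, rfl⟩) v : ℤ) - G.dist (rep ⟨φ x, x, rfl⟩) z =
          G.dist x v - G.dist x z := fun v hv => congrFun hx ⟨v, by rw [hR]; exact hv⟩
    have h1 := h.hull_sub_le hconn hf hloc
    have h2 := h.hull_sub_le hconn hf fun v hv => (hloc v hv).symm
    have h3 := h.hull_sub_le hconn hg hloc
    have h4 := h.hull_sub_le hconn hg fun v hv => (hloc v hv).symm
    omega

end StableIntervals

/-! ### Geometric actions: local finiteness, passage to the hull, transport to `Type`. -/

section GeometricAction

variable {Γ : Type u} [Group Γ] {V : Type v} {G : SimpleGraph V} {ρ : Γ →* (G ≃g G)}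

theorem apply_inv_apply (ρ : Γ →* (G ≃g G)) (g : Γ) (x : V) : ρ g⁻¹ (ρ g x) = x := by
  have : (ρ g⁻¹ * ρ g) x = x := by rw [← map_mul, inv_mul_cancel, map_one]; rfl
  exact this

theorem IsGeometricAction.finite_setOf_apply_mem (hρ : IsGeometricAction ρ) (x : V) {K : Set V}
    (hK : K.Finite) : {g : Γ | ρ g x ∈ K}.Finite := by
  have hfib : ∀ y ∈ K, {g : Γ | ρ g x = y}.Finite := fun y _ => by
    rcases {g : Γ | ρ g x = y}.eq_empty_or_nonempty with he | ⟨g₀, hg₀⟩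
    · rw [he]
      exact Set.finite_empty
    · refine ((hρ.finite_stabilizer x).image fun g => g₀ * g).subset fun g hg => ?_
      refine ⟨g₀⁻¹ * g, ?_, by simp⟩
      rw [Set.mem_ofPred_eq] at hg hg₀ ⊢
      rw [map_mul, RelIso.mul_apply, hg, ← hg₀, apply_inv_apply]
  refine (hK.biUnion hfib).subset fun g hg => ?_
  simpa using hg

/-- Each edge at `x` is carried into `K` by some `g` with `g x ∈ K`; there are finitely many such
`g`, and each accounts for finitely many neighbours. -/
theorem IsGeometricAction.finite_neighborSet (hρ : IsGeometricAction ρ) (x : V) :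
    (G.neighborSet x).Finite := by
  obtain ⟨K, hK, -, hedge⟩ := hρ.cocompact
  refine ((hρ.finite_setOf_apply_mem x hK).biUnion fun g _ => hK.image (ρ g⁻¹)).subset
    fun y hy => ?_
  obtain ⟨g, hgx, hgy⟩ := hedge x y hy
  simp only [Set.mem_iUnion]
  exact ⟨g, hgx, ρ g y, hgy, apply_inv_apply ρ g y⟩

theorem finite_ball (hconn : G.Connected) (h : ∀ x, (G.neighborSet x).Finite) (x : V) (r : ℕ) :
    (ball G x r).Finite := by
  induction r generalizing x with
  | zero =>
    refine (Set.finite_singleton x).subset fun y hy => ?_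
    exact (hconn.dist_eq_zero_iff.1 (Nat.le_zero.1 hy)).symm
  | succ r ih =>
    refine (((h x).biUnion fun y _ => ih y).union (Set.finite_singleton x)).subset fun y hy => ?_
    obtain ⟨p, hp⟩ := hconn.exists_walk_length_eq_dist x y
    cases p with
    | nil => exact Or.inr rfl
    | @cons _ w _ hadj p =>
      refine Or.inl (Set.mem_biUnion (x := w) hadj ((SimpleGraph.dist_le p).trans ?_))
      rw [SimpleGraph.Walk.length_cons] at hp
      have : G.dist x y ≤ r + 1 := hy
      omega

/-- Countability allows the hull to be replaced by a graph on a vertex set in `Type`, as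
`IsHellyGroup` demands. -/
theorem countable_of_finite_ball (hconn : G.Connected) (h : ∀ x r, (ball G x r).Finite) :
    Countable V := by
  obtain ⟨x⟩ := hconn.nonempty
  rw [← Set.countable_univ_iff]
  refine (Set.countable_iUnion fun r => (h x r).countable).mono fun y _ => ?_
  exact Set.mem_iUnion.2 ⟨G.dist x y, le_refl (G.dist x y)⟩

@[simp]
theorem hullAut_apply_apply (φ : G ≃g G) (f : Hull G) (x : V) :
    (hullAut G φ f).1 (φ x) = f.1 x := by
  change f.1 (φ.symm (φ x)) = f.1 x
  rw [RelIso.symm_apply_apply]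

theorem IsGeometricAction.hull (hρ : IsGeometricAction ρ) (hball : ∀ x r, (ball G x r).Finite)
    (hfin : ∀ (z : V) (N : ℕ), {f : Hull G | f.1 z ≤ N}.Finite) {N : ℕ}
    (hN : ∀ f : Hull G, ∃ z, f.1 z ≤ N) : IsGeometricAction ((hullAut G).comp ρ) where
  finite_stabilizer f := by
    obtain ⟨z, hz⟩ := hN f
    refine (hρ.finite_setOf_apply_mem z (hball z (2 * N))).subset fun g hg => ?_
    have h1 := hullAut_apply_apply (ρ g) f z
    have h2 : hullAut G (ρ g) f = f := hg
    rw [h2] at h1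
    -- If `g` fixes `f`, then `f (g z) = f z ≤ N`, so `g` moves `z` by at most `2 * N`.
    have h3 := f.2.1 z (ρ g z)
    rw [Set.mem_ofPred_eq, ball, Set.mem_ofPred_eq]
    omega
  cocompact := by
    obtain ⟨K, hK, hvert, -⟩ := hρ.cocompact
    have hmem : ∀ f : Hull G, ∃ (g : Γ) (z : V), ρ g z ∈ K ∧ f.1 z ≤ N := fun f => by
      obtain ⟨z, hz⟩ := hN f
      obtain ⟨g, hg⟩ := hvert z
      exact ⟨g, z, hg, hz⟩
    -- The bound is `N + 1` rather than `N` so that both ends of an edge are captured: adjacent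
    -- forms differ by at most one at `z`.
    have hin : ∀ (f : Hull G) (g : Γ) (z : V), ρ g z ∈ K → f.1 z ≤ (N + 1 : ℕ) →
        ((hullAut G).comp ρ) g f ∈ ⋃ z ∈ K, {f : Hull G | f.1 z ≤ (N + 1 : ℕ)} :=
      fun f g z hg hz => Set.mem_biUnion hg ((hullAut_apply_apply (ρ g) f z).trans_le hz)
    refine ⟨⋃ z ∈ K, {f : Hull G | f.1 z ≤ (N + 1 : ℕ)}, hK.biUnion fun z _ => hfin z _,
      fun f => ?_, fun f f' hadj => ?_⟩
    · obtain ⟨g, z, hg, hz⟩ := hmem f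
      exact ⟨g, hin f g z hg (by omega)⟩
    · obtain ⟨g, z, hg, hz⟩ := hmem f
      have := abs_le.1 (hadj.2 z)
      exact ⟨g, hin f g z hg (by omega), hin f' g z hg (by omega)⟩

theorem IsHellyGraph.of_iso {W : Type*} {H : SimpleGraph W} (e : G ≃g H) (hG : IsHellyGraph G) :
    IsHellyGraph H := by
  have hdist : ∀ x y : W, G.dist (e.symm x) (e.symm y) = H.dist x y := fun x y => by
    refine le_antisymm ?_ ?_
    · obtain ⟨p, hp⟩ := (e.connected_iff.1 hG.connected).exists_walk_length_eq_dist x y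
      rw [← hp, ← SimpleGraph.Walk.length_map e.symm.toHom p]
      exact SimpleGraph.dist_le _
    · obtain ⟨p, hp⟩ := hG.connected.exists_walk_length_eq_dist (e.symm x) (e.symm y)
      rw [← hp, ← SimpleGraph.Walk.length_map e.toHom p]
      refine le_of_eq_of_le ?_ (SimpleGraph.dist_le _)
      simp
  refine ⟨e.connected_iff.1 hG.connected, fun S hS => ?_⟩
  obtain ⟨z, hz⟩ := hG.helly ((fun p : W × ℕ => (e.symm p.1, p.2)) '' S) (by
    rintro _ ⟨p, hp, rfl⟩ _ ⟨q, hq, rfl⟩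
    obtain ⟨m, hm1, hm2⟩ := hS p hp q hq
    exact ⟨e.symm m, (hdist _ _).trans_le hm1, (hdist _ _).trans_le hm2⟩)
  refine ⟨e z, fun p hp => ?_⟩
  have := hz _ ⟨p, hp, rfl⟩
  rw [ball, Set.mem_ofPred_eq, ← hdist, RelIso.symm_apply_apply]
  exact this

/-- Transport of an action along an isomorphism of graphs. -/
def conjAction {W : Type*} {H : SimpleGraph W} (e : G ≃g H) (ρ : Γ →* (G ≃g G)) :
    Γ →* (H ≃g H) where
  toFun g := (e.symm.trans (ρ g)).trans e
  map_one' := by ext x; simp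
  map_mul' g h := by ext x; simp

theorem conjAction_apply {W : Type*} {H : SimpleGraph W} (e : G ≃g H) (ρ : Γ →* (G ≃g G)) (g : Γ)
    (x : W) : conjAction e ρ g x = e (ρ g (e.symm x)) :=
  rfl

theorem IsGeometricAction.conj {W : Type*} {H : SimpleGraph W} (e : G ≃g H)
    (hρ : IsGeometricAction ρ) : IsGeometricAction (conjAction e ρ) where
  finite_stabilizer x := by
    refine (hρ.finite_stabilizer (e.symm x)).subset fun g hg => ?_
    rw [Set.mem_ofPred_eq, conjAction_apply] at hg
    exact e.injective (hg.trans (e.apply_symm_apply x).symm)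
  cocompact := by
    obtain ⟨K, hK, hvert, hedge⟩ := hρ.cocompact
    refine ⟨e '' K, hK.image _, fun x => ?_, fun x y hxy => ?_⟩
    · obtain ⟨g, hg⟩ := hvert (e.symm x)
      exact ⟨g, _, hg, rfl⟩
    · obtain ⟨g, hgx, hgy⟩ := hedge _ _ (e.symm.map_adj_iff.2 hxy)
      exact ⟨g, ⟨_, hgx, rfl⟩, ⟨_, hgy, rfl⟩⟩

/-- A group acting geometrically on a Helly graph with countably many vertices, in any universe, is
a Helly group. -/
theorem IsHellyGraph.isHellyGroup [Countable V] (hG : IsHellyGraph G)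
    (hρ : IsGeometricAction ρ) : IsHellyGroup Γ := by
  let e : G ≃g G.comap (equivShrink.{0} V).symm :=
    (SimpleGraph.Iso.comap (equivShrink.{0} V).symm G).symm
  exact ⟨Shrink.{0} V, _, conjAction e ρ, hG.of_iso e, hρ.conj e⟩

end GeometricAction

end HellyGroups

theorem theorem1p2 {Γ : Type u} [Group Γ] {V : Type v} (G : SimpleGraph V) (hconn : G.Connected)
    (hcoarse : HellyGroups.IsCoarseHelly G)
    (β : ℝ) (hβ : 1 ≤ β) (hstable : HellyGroups.HasStableIntervals G β)
    (ρ : Γ →* (G ≃g G)) (hρ : HellyGroups.IsGeometricAction ρ) :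
    HellyGroups.IsHellyGroup Γ ∧
      HellyGroups.IsHellyGraph (HellyGroups.hullGraph G) ∧
      HellyGroups.IsGeometricAction ((HellyGroups.hullAut G).comp ρ) := by
  have hball := HellyGroups.finite_ball hconn hρ.finite_neighborSet
  have hfin := hstable.finite_hull hconn hball
  obtain ⟨N, hN⟩ := hcoarse.exists_hull_le hconn
  have hhelly := HellyGroups.isHellyGraph_hullGraph hconn
  have hgeom := hρ.hull hball hfin hN
  have : Countable V := HellyGroups.countable_of_finite_ball hconn hball
  have : Countable (HellyGroups.Hull G) := by
    rw [← Set.countable_univ_iff]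
    refine (Set.countable_iUnion fun z => (hfin z N).countable).mono fun f _ => ?_
    exact Set.mem_iUnion.2 (hN f)
  exact ⟨hhelly.isHellyGroup hgeom, hhelly, hgeom⟩
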